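/- Let $K$ be an arbitrary field, let $K[x]=K[x_1,\dots,x_n]$ be the polynomial ring in $n$ variables, and let $F=x+H\in K[x]^n$ be a polynomial map, that is, $F_i=x_i+H_i$ with $H_i\in K[x]$ for $1\le i\le n$. Write $\mathcal{J}F=(\partial F_i/\partial x_j)_{i,j}$ and $\mathcal{J}H=(\partial H_i/\partial x_j)_{i,j}$ for the Jacobian matrices. Suppose that $F$ is a Keller map, i.e. $\det\mathcal{J}F\in K^*=K\setminus\{0\}$, and that the subfield $K(H)=K(H_1,\dots,H_n)$ of $K(x)$ has transcendence degree $1$ over $K$. Then $\mathcal{J}H$ is similar over $K$ to a triangular matrix, i.e. there exists $T\in\operatorname{GL}_n(K)$ such that $T^{-1}(\mathcal{J}H)T$ is a (lower or upper) triangular matrix over $K[x]$. Moreover, the following statements are equivalent: (1) $\det\mathcal{J}F=1$; (2) $\mathcal{J}H$ is nilpotent; (3) $(\mathcal{J}H)\cdot(\mathcal{J}H)|_{x=y}=0$, where $y=(y_1,\dots,y_n)$ are $n$ new variables and $|_{x=y}$ denotes the substitution of $y$ for $x$. -/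

import Mathlib

namespace PolyMap

noncomputable section

open MvPolynomial

/-- The Jacobian matrix `(∂Fᵢ/∂xⱼ)` of a polynomial map `F = (F₁, …, F_m)` in `n` variables. -/
def jacobian {K : Type*} [Field K] {m n : ℕ} (F : Fin m → MvPolynomial (Fin n) K) :
    Matrix (Fin m) (Fin n) (MvPolynomial (Fin n) K) :=
  Matrix.of fun i j => pderiv j (F i)

/-- `F` is a Keller map: the determinant of its Jacobian matrix is a nonzero constant. -/
def IsKeller {K : Type*} [Field K] {n : ℕ} (F : Fin n → MvPolynomial (Fin n) K) : Prop :=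
  ∃ c : K, c ≠ 0 ∧ (jacobian F).det = C c

/-- The subfield `K(H) = K(H₁, …, H_m)` of the field `K(x)` of rational functions. -/
def genField {K : Type*} [Field K] {m n : ℕ} (H : Fin m → MvPolynomial (Fin n) K) :
    IntermediateField K (FractionRing (MvPolynomial (Fin n) K)) :=
  IntermediateField.adjoin K
    (Set.range fun i => algebraMap (MvPolynomial (Fin n) K)
      (FractionRing (MvPolynomial (Fin n) K)) (H i))

/-- `M` is similar over `K` to `N`: there is `T ∈ GL_n(K)` with `N = T⁻¹ M T`. -/
def SimilarOver {K : Type*} [Field K] {n : ℕ}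
    (M N : Matrix (Fin n) (Fin n) (MvPolynomial (Fin n) K)) : Prop :=
  ∃ T : GL (Fin n) K,
    N = (T⁻¹ : GL (Fin n) K).val.map (C : K →+* MvPolynomial (Fin n) K) * M *
      T.val.map (C : K →+* MvPolynomial (Fin n) K)

/-- A square matrix is triangular if it is upper triangular or lower triangular. -/
def IsTriangular {R : Type*} [Zero R] {n : ℕ} (M : Matrix (Fin n) (Fin n) R) : Prop :=
  (∀ i j : Fin n, j < i → M i j = 0) ∨ (∀ i j : Fin n, i < j → M i j = 0)

/-- A matrix over `K[x]`, viewed over `K[x, y]`, where `x` and `y` are `n` variables each. -/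
def inX {K : Type*} [Field K] {n : ℕ} (M : Matrix (Fin n) (Fin n) (MvPolynomial (Fin n) K)) :
    Matrix (Fin n) (Fin n) (MvPolynomial (Fin n ⊕ Fin n) K) :=
  M.map (rename Sum.inl)

/-- The matrix `M|_{x=y}` over `K[x, y]`, obtained from `M` over `K[x]` by substituting the
new variables `y` for `x`. -/
def inY {K : Type*} [Field K] {n : ℕ} (M : Matrix (Fin n) (Fin n) (MvPolynomial (Fin n) K)) :
    Matrix (Fin n) (Fin n) (MvPolynomial (Fin n ⊕ Fin n) K) :=
  M.map (rename Sum.inr)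

end

end PolyMap

/-! Transcendence degree one makes every `H i` a polynomial `g i` in a single `h ∈ K[x]`
(`exists_eq_aeval_of_trdeg_le_one`): a monomial curve embeds `K[H]` in `K[t]`, Lüroth's theorem
gives a polynomial generator there, and integrality brings it back to `K[x]`. Hence `JH = g'(h) ·
∇h` has rank at most one and `det JF = 1 + tr JH`.

Some constant `T` gives the entries `a i` of `T g'` strictly decreasing degrees
(`exists_GL_mulVec_degree_lt`). With `w = ∇h T⁻¹`, the trace `∑ a i (h) w i` is constant and `deg (w
i) < deg h`, so summands cannot cancel and a nonzero one has constant `a i` (`sum_aeval_mul_eq_C`).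
A nonzero entry `a i (h) w j` with `j < i` would need `deg (a j) > deg (a i)` although `w j ≠ 0`
makes `a j` constant; so `T JH T⁻¹` is upper triangular. If `det JF = 1`, then for each `k` one of
`a k (h)`, `w k` is zero, which gives (3). -/

namespace PolyMap

/-! ### Lüroth's theorem with polynomial generators -/

section Luroth

open Polynomial IntermediateField

variable {K : Type*} [Field K]

/-- A rational function that is not of positive order at infinity, minus its value there,
vanishes at infinity. -/
theorem exists_inftyValuation_sub_C_lt_one [DecidableEq (RatFunc K)] {θ : RatFunc K}
    (hθ : RatFunc.inftyValuation K θ ≤ 1) :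
    ∃ c : K, RatFunc.inftyValuation K (θ - RatFunc.C c) < 1 := by
  have key : ∀ p : K[X], p ≠ 0 → RatFunc.inftyValuation K (algebraMap K[X] (RatFunc K) p) =
      WithZero.exp (p.natDegree : ℤ) := fun p hp => RatFunc.inftyValuation.polynomial K hp
  have hw := θ.denom_ne_zero
  have hw' : algebraMap K[X] (RatFunc K) θ.denom ≠ 0 := RatFunc.algebraMap_ne_zero hw
  have hdeg : θ.num.natDegree ≤ θ.denom.natDegree := by
    by_cases hu : θ.num = 0
    · simp [hu]
    rw [← RatFunc.num_div_denom θ, map_div₀, key _ hu, key _ hw] at hθ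
    rw [div_le_one₀ (by simp)] at hθ
    simpa using hθ
  -- The value of `θ` at infinity; it is zero when the numerator has smaller degree than the
  -- denominator.
  set c := θ.num.coeff θ.denom.natDegree / θ.denom.leadingCoeff with hc
  refine ⟨c, ?_⟩
  have hlc : θ.denom.leadingCoeff ≠ 0 := leadingCoeff_ne_zero.2 hw
  have hr : (θ.num - C c * θ.denom).degree < θ.denom.degree := by
    rw [degree_eq_natDegree hw, degree_lt_iff_coeff_zero]
    intro m hm
    rcases hm.eq_or_lt with rfl | hm
    · simp only [coeff_sub, coeff_C_mul, hc, coeff_natDegree]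
      field_simp
      simp
    · rw [coeff_eq_zero_of_natDegree_lt]
      refine lt_of_le_of_lt ?_ hm
      exact (natDegree_sub_le _ _).trans (max_le hdeg (natDegree_C_mul_le _ _))
  have heq : θ - RatFunc.C c = algebraMap K[X] (RatFunc K) (θ.num - C c * θ.denom) /
      algebraMap K[X] (RatFunc K) θ.denom := by
    rw [map_sub, map_mul, sub_div, mul_div_cancel_right₀ _ hw', RatFunc.num_div_denom,
      RatFunc.algebraMap_C]
  rw [heq]
  by_cases h0 : θ.num - C c * θ.denom = 0
  · simp [h0]
  · rw [map_div₀, key _ h0, key _ hw, div_lt_one₀ (by simp)]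
    have := natDegree_lt_natDegree h0 hr
    simpa using this

/-- **Lüroth's theorem**, with a generator that has a pole at infinity. -/
theorem exists_eq_adjoin_simple_one_lt_inftyValuation [DecidableEq (RatFunc K)]
    {E : IntermediateField K (RatFunc K)} (hE : E ≠ ⊥) :
    ∃ θ : RatFunc K, E = K⟮θ⟯ ∧ 1 < RatFunc.inftyValuation K θ := by
  obtain ⟨θ, hθ⟩ : ∃ θ : RatFunc K, E = K⟮θ⟯ := ⟨_, RatFunc.Luroth.eq_adjoin_generator⟩
  rcases lt_or_ge 1 (RatFunc.inftyValuation K θ) with h | h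
  · exact ⟨θ, hθ, h⟩
  obtain ⟨c, hc⟩ := exists_inftyValuation_sub_C_lt_one h
  have hne : θ - RatFunc.C c ≠ 0 := by
    intro h0
    apply hE
    rw [hθ, adjoin_simple_eq_bot_iff, sub_eq_zero.1 h0]
    exact ⟨c, rfl⟩
  have hCmem : ∀ L : IntermediateField K (RatFunc K), RatFunc.C c ∈ L :=
    fun L => L.algebraMap_mem c
  refine ⟨(θ - RatFunc.C c)⁻¹, ?_, ?_⟩
  · rw [hθ]
    apply le_antisymm
    · rw [adjoin_simple_le_iff]
      have h1 : θ - RatFunc.C c ∈ K⟮(θ - RatFunc.C c)⁻¹⟯ := by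
        simpa using inv_mem (mem_adjoin_simple_self K (θ - RatFunc.C c)⁻¹)
      simpa using add_mem h1 (hCmem _)
    · rw [adjoin_simple_le_iff]
      exact inv_mem (sub_mem (mem_adjoin_simple_self K θ) (hCmem _))
  · rw [map_inv₀]
    exact (one_lt_inv₀ (by simpa [zero_lt_iff] using hne)).2 hc

/-- An element at which two polynomials over `K` of different degrees have a ratio in `R`
is integral over `R`. -/
theorem isIntegral_of_aeval_eq_mul_aeval {R S : Type*} [CommRing R] [CommRing S] [Algebra K R]
    [Algebra K S] [Algebra R S] [IsScalarTower K R S] {s : S} {A B : K[X]} (p : R)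
    (hdeg : B.degree < A.degree) (h : aeval s A = algebraMap R S p * aeval s B) :
    IsIntegral R s := by
  nontriviality R
  have hA : A ≠ 0 := by
    rintro rfl
    simp at hdeg
  have hmonic : ((A * C A.leadingCoeff⁻¹).map (algebraMap K R)).Monic :=
    (monic_mul_leadingCoeff_inv hA).map _
  refine ⟨(A * C A.leadingCoeff⁻¹).map (algebraMap K R) -
    C (p * algebraMap K R A.leadingCoeff⁻¹) * B.map (algebraMap K R), hmonic.sub_of_left ?_, ?_⟩
  · rw [degree_map, degree_mul_leadingCoeff_inv _ hA]
    refine lt_of_le_of_lt ?_ hdeg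
    rw [← smul_eq_C_mul]
    exact (degree_smul_le _ _).trans degree_map_le
  · rw [← aeval_def]
    simp only [map_sub, map_mul, aeval_map_algebraMap, aeval_C, h,
      ← IsScalarTower.algebraMap_apply]
    ring

/-- A field `K(θ)` that contains a nonconstant polynomial has a polynomial generator, provided
that `θ` has a pole at infinity. -/
theorem exists_algebraMap_eq_of_one_lt_inftyValuation [DecidableEq (RatFunc K)] {θ : RatFunc K}
    (hθ : 1 < RatFunc.inftyValuation K θ) {P : K[X]} (hP0 : 0 < P.natDegree)
    (hP : algebraMap K[X] (RatFunc K) P ∈ K⟮θ⟯) :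
    ∃ u : K[X], algebraMap K[X] (RatFunc K) u = θ := by
  obtain ⟨A, B, hAB⟩ := (mem_adjoin_simple_iff K _).1 hP
  have hPne : P ≠ 0 := by
    rintro rfl
    simp at hP0
  have hPne' : algebraMap K[X] (RatFunc K) P ≠ 0 := RatFunc.algebraMap_ne_zero hPne
  have hAθ : aeval θ A ≠ 0 := fun h => hPne' (by rw [hAB, h, zero_div])
  have hBθ : aeval θ B ≠ 0 := fun h => hPne' (by rw [hAB, h, div_zero])
  have hA0 : A ≠ 0 := fun h => hAθ (by simp [h])
  have hB0 : B ≠ 0 := fun h => hBθ (by simp [h])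
  -- Since `θ` has a pole, the leading term of a polynomial in `θ` dominates at infinity. As `P`
  -- also has a pole there, `A` has larger degree than `B`, and `A(θ) = P B(θ)` makes `θ` integral
  -- over `K[X]`.
  have hval : ∀ p : K[X], p ≠ 0 → RatFunc.inftyValuation K (aeval θ p) =
      RatFunc.inftyValuation K θ ^ p.natDegree := fun p hp =>
    valuation_aeval_eq_valuation_X_pow_natDegree_of_one_lt_valuation_X θ hθ hp
  have hPv : 1 < RatFunc.inftyValuation K (algebraMap K[X] (RatFunc K) P) := by
    rw [show RatFunc.inftyValuation K (algebraMap K[X] (RatFunc K) P) =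
      WithZero.exp (P.natDegree : ℤ) from RatFunc.inftyValuation.polynomial K hPne]
    rw [← WithZero.exp_zero, WithZero.exp_lt_exp]
    exact_mod_cast hP0
  have hlt : B.natDegree < A.natDegree := by
    rw [hAB, map_div₀, hval A hA0, hval B hB0,
      one_lt_div₀ (pow_pos (zero_lt_one.trans hθ) _)] at hPv
    exact (pow_lt_pow_iff_right₀ hθ).1 hPv
  refine IsIntegrallyClosed.isIntegral_iff.1
    (isIntegral_of_aeval_eq_mul_aeval (A := A) (B := B) P (degree_lt_degree hlt) ?_)
  rw [hAB, div_mul_cancel₀ _ hBθ]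

/-- For a nonconstant polynomial `u`, the polynomials in `K(u)` are polynomials in `u`. -/
theorem exists_aeval_eq_of_mem_adjoin_simple {u : K[X]} (hu : 0 < u.natDegree) {P : K[X]}
    (hP : algebraMap K[X] (RatFunc K) P ∈ K⟮algebraMap K[X] (RatFunc K) u⟯) :
    ∃ g : K[X], g.comp u = P := by
  obtain ⟨A, B, hAB⟩ := (mem_adjoin_simple_iff K _).1 hP
  by_cases hB0 : B = 0
  · refine ⟨0, RatFunc.algebraMap_injective K ?_⟩
    simp [hAB, hB0]
  have hcomp : ∀ p : K[X], aeval (algebraMap K[X] (RatFunc K) u) p =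
      algebraMap K[X] (RatFunc K) (p.comp u) := fun p => by
    rw [aeval_algebraMap_apply, comp_eq_aeval]
  have hBu : B.comp u ≠ 0 := fun h => by
    rcases comp_eq_zero_iff.1 h with h | h
    · exact hB0 h
    · rw [h.2, natDegree_C] at hu
      exact hu.false
  rw [hcomp, hcomp, eq_div_iff (RatFunc.algebraMap_ne_zero hBu), ← map_mul] at hAB
  have hAB' := RatFunc.algebraMap_injective K hAB
  -- The remainder `r` of `A` by `B` satisfies `(P - (A / B)(u)) B(u) = r(u)`, whose right side has
  -- too small a degree unless the first factor is zero.
  refine ⟨A / B, ?_⟩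
  by_contra hne
  have hD : (P - (A / B).comp u) * B.comp u = (A % B).comp u := by
    rw [sub_mul, hAB']
    nth_rewrite 1 [← EuclideanDomain.div_add_mod A B]
    simp only [add_comp, mul_comp]
    ring
  have hP0 : P - (A / B).comp u ≠ 0 := fun h => hne (sub_eq_zero.1 h).symm
  have hr : A % B ≠ 0 := fun h => mul_ne_zero hP0 hBu (by rw [hD, h, zero_comp])
  have hlt : (A % B).natDegree < B.natDegree :=
    natDegree_lt_natDegree hr (EuclideanDomain.mod_lt A hB0)
  have := congrArg natDegree hD
  rw [natDegree_mul hP0 hBu, natDegree_comp, natDegree_comp] at this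
  have := Nat.mul_lt_mul_of_pos_right hlt hu
  lia

end Luroth

end PolyMap

namespace PolyMap

/-! ### A common polynomial for the components of `H` -/

section CommonPolynomial

open Polynomial

variable {K : Type*} [Field K] {n : ℕ}

theorem _root_.Nat.ofDigits_ofFn (b : ℕ) {n : ℕ} (r : Fin n → ℕ) :
    Nat.ofDigits b (List.ofFn r) = ∑ i : Fin n, b ^ (i : ℕ) * r i := by
  induction n with
  | zero => simp
  | succ n ih =>
    rw [List.ofFn_succ, Nat.ofDigits_cons, ih, Fin.sum_univ_succ, Finset.mul_sum]
    simp [pow_succ', mul_assoc]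

/-- A nonconstant polynomial stays nonconstant on a suitable monomial curve. -/
theorem exists_algHom_natDegree_pos {f : MvPolynomial (Fin n) K}
    (hf : ∀ c, f ≠ MvPolynomial.C c) :
    ∃ φ : MvPolynomial (Fin n) K →ₐ[K] K[X], 0 < (φ f).natDegree := by
  obtain ⟨s, hs, hs0⟩ : ∃ s ∈ f.support, s ≠ 0 := by
    by_contra! h
    refine hf (f.coeff 0) ?_
    ext s
    rw [MvPolynomial.coeff_C]
    split_ifs with h0
    · rw [h0]
    · exact MvPolynomial.notMem_support_iff.1 fun hs => h0 (h s hs).symm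
  -- Kronecker substitution `x_i ↦ t ^ N ^ i`: exponents of `f` are base-`N` digits, so its
  -- monomials have distinct images. The `2` also ensures `1 < N`.
  set N := f.totalDegree + 2 with hN
  let wt : (Fin n →₀ ℕ) → ℕ := fun s => Nat.ofDigits N (List.ofFn s)
  have hlt : ∀ r ∈ f.support, ∀ l ∈ List.ofFn r, l < N := by
    intro r hr l hl
    obtain ⟨i, rfl⟩ := (List.mem_ofFn' _ _).1 hl
    have h1 := MvPolynomial.le_totalDegree hr
    have h2 : r i ≤ r.sum fun _ e => e := by
      by_cases hi : i ∈ r.support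
      · exact Finset.single_le_sum (f := fun j => r j) (fun _ _ => Nat.zero_le _) hi
      · simp [Finsupp.notMem_support_iff.1 hi]
    lia
  have hinj : ∀ r ∈ f.support, wt r = wt s → r = s := by
    intro r hr h
    have := Nat.ofDigits_inj_of_len_eq (by lia) (by simp) (hlt r hr) (hlt s hs) h
    exact DFunLike.coe_injective (List.ofFn_injective this)
  have hwt : ∀ r : Fin n →₀ ℕ, ∏ i : Fin n, (X ^ N ^ (i : ℕ) : K[X]) ^ r i = X ^ wt r := by
    intro r
    simp only [← pow_mul, Finset.prod_pow_eq_pow_sum, wt, Nat.ofDigits_ofFn]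
  refine ⟨MvPolynomial.aeval fun i : Fin n => X ^ N ^ (i : ℕ), ?_⟩
  have hcoeff : (MvPolynomial.aeval (fun i : Fin n => (X ^ N ^ (i : ℕ) : K[X])) f).coeff (wt s) =
      f.coeff s := by
    rw [MvPolynomial.aeval_def, MvPolynomial.eval₂_eq', finsetSum_coeff]
    simp only [hwt, algebraMap_eq, coeff_C_mul, coeff_X_pow]
    rw [Finset.sum_eq_single_of_mem s hs]
    · simp
    · intro r hr hrs
      rw [if_neg fun h => hrs (hinj r hr h.symm), mul_zero]
  have hpos : 0 < wt s := by
    rw [Nat.pos_iff_ne_zero]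
    intro h0
    simp only [wt, Nat.ofDigits_ofFn, Finset.sum_eq_zero_iff, Finset.mem_univ, true_imp_iff,
      mul_eq_zero] at h0
    refine hs0 (Finsupp.ext fun i => (h0 i).resolve_left ?_)
    exact pow_ne_zero _ (by lia)
  refine hpos.trans_le (le_natDegree_of_ne_zero ?_)
  rw [hcoeff]
  exact MvPolynomial.mem_support_iff.1 hs

/-- A homomorphism to `K[t]` that does not send all of a domain of transcendence degree at most
`1` to constants is injective. -/
theorem algHom_injective_of_trdeg_le_one {A : Type*} [CommRing A] [IsDomain A] [Algebra K A]
    (htr : Algebra.trdeg K A ≤ 1) (φ : A →ₐ[K] K[X]) {f : A} (hf : 0 < (φ f).natDegree) :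
    Function.Injective φ := by
  have hφf : ∀ q : K[X], φ (aeval f q) = 0 → q = 0 := by
    intro q hq
    rw [← aeval_algHom_apply, ← comp_eq_aeval] at hq
    rcases comp_eq_zero_iff.1 hq with h | h
    · exact h
    · rw [h.2, natDegree_C] at hf
      exact absurd hf (lt_irrefl _)
  have htrans : Transcendental K f := by
    rw [transcendental_iff]
    exact fun q hq => hφf q (by rw [hq, map_zero])
  have hind : AlgebraicIndependent K (fun _ : PUnit => f) :=
    algebraicIndependent_unique_type_iff.2 htrans
  have halg := (hind.isTranscendenceBasis_of_trdeg_le_of_finite (by simpa using htr)).isAlgebraic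
  rw [injective_iff_map_eq_zero]
  intro a ha
  by_contra ha0
  -- `A` is algebraic over `K[f]`, so a nonzero `a` in the kernel divides some nonzero `q(f)`; but
  -- then `q(φ f) = 0` with `φ f` nonconstant.
  obtain ⟨⟨r, hr⟩, hr0, b, hb⟩ :=
    (halg.isAlgebraic a).exists_nonzero_dvd (mem_nonZeroDivisors_of_ne_zero ha0)
  rw [Set.range_const, Algebra.adjoin_singleton_eq_range_aeval] at hr
  obtain ⟨q, rfl⟩ := hr
  have hq : q = 0 := hφf q (by
    change φ ((aeval f).toRingHom q) = 0
    rw [show ((aeval f).toRingHom q : A) = a * b from hb, map_mul, ha, zero_mul])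
  exact hr0 (Subtype.ext (by simp [hq]))

/-- In the fraction field of a subalgebra `A ≠ K` of `K[t]` there is an element `η` such that
`A` consists of polynomials in `η`. -/
theorem exists_forall_algebraMap_eq_aeval {A Q : Type*} [CommRing A] [IsDomain A] [Algebra K A]
    [Field Q] [Algebra A Q] [IsFractionRing A Q] [Algebra K Q] [IsScalarTower K A Q]
    (φ : A →ₐ[K] K[X]) (hφ : Function.Injective φ) {f : A} (hf : 0 < (φ f).natDegree) :
    ∃ η : Q, ∀ a, ∃ g : K[X], aeval η g = algebraMap A Q a := by
  classical
  let ψ₀ : A →ₐ[K] RatFunc K := (IsScalarTower.toAlgHom K K[X] (RatFunc K)).comp φ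
  have hψ₀ : Function.Injective ψ₀ := (RatFunc.algebraMap_injective K).comp hφ
  let ψ : Q →ₐ[K] RatFunc K := IsFractionRing.liftAlgHom hψ₀
  have hψ : ∀ a, ψ (algebraMap A Q a) = algebraMap K[X] (RatFunc K) (φ a) := fun a =>
    IsFractionRing.lift_algebraMap hψ₀ a
  have hmem : ∀ a, algebraMap K[X] (RatFunc K) (φ a) ∈ ψ.fieldRange := fun a => ⟨_, hψ a⟩
  have hbot : ψ.fieldRange ≠ ⊥ := by
    intro hb
    have := hmem f
    rw [hb, IntermediateField.mem_bot] at this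
    obtain ⟨c, hc⟩ := this
    rw [RatFunc.algebraMap_eq_C, ← RatFunc.algebraMap_C] at hc
    rw [← RatFunc.algebraMap_injective K hc, natDegree_C] at hf
    exact hf.false
  obtain ⟨θ, hE, hθ⟩ := exists_eq_adjoin_simple_one_lt_inftyValuation hbot
  obtain ⟨u, rfl⟩ := exists_algebraMap_eq_of_one_lt_inftyValuation hθ hf (hE ▸ hmem f)
  have hu : 0 < u.natDegree := by
    by_contra hu
    rw [eq_C_of_natDegree_eq_zero (by lia : u.natDegree = 0)] at hE
    apply hbot
    rw [hE, IntermediateField.adjoin_simple_eq_bot_iff, RatFunc.algebraMap_C]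
    exact ⟨_, rfl⟩
  obtain ⟨η, hη⟩ : algebraMap K[X] (RatFunc K) u ∈ ψ.fieldRange :=
    hE ▸ IntermediateField.mem_adjoin_simple_self K _
  refine ⟨η, fun a => ?_⟩
  obtain ⟨g, hg⟩ := exists_aeval_eq_of_mem_adjoin_simple hu (hE ▸ hmem a)
  refine ⟨g, ψ.injective ?_⟩
  change ψ _ = ψ _
  rw [hψ, ← aeval_algHom_apply, ← hg, comp_eq_aeval, ← aeval_algebraMap_apply]
  exact congrArg (aeval · g) hη

/-- A `K`-algebra `A` that embeds in `K[t]` consists of polynomials in a single element of any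
integrally closed domain in which it lies. -/
theorem exists_forall_aeval_eq_of_injective {A R : Type*} [CommRing A] [IsDomain A]
    [Algebra K A] [CommRing R] [IsDomain R] [IsIntegrallyClosed R] [Algebra K R] (φ : A →ₐ[K] K[X])
    (hφ : Function.Injective φ) {f : A} (hf : 0 < (φ f).natDegree) (j : A →ₐ[K] R)
    (hj : Function.Injective j) :
    ∃ h : R, ∀ a, ∃ g : K[X], j a = aeval h g := by
  let toL : A →ₐ[K] FractionRing R := (IsScalarTower.toAlgHom K R (FractionRing R)).comp j
  have htoL : Function.Injective toL := (IsFractionRing.injective R (FractionRing R)).comp hj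
  obtain ⟨η, hη⟩ := exists_forall_algebraMap_eq_aeval (Q := FractionRing A) φ hφ hf
  choose g hg using hη
  let ι : FractionRing A →ₐ[K] FractionRing R := IsFractionRing.liftAlgHom htoL
  have hιη : ∀ a, aeval (ι η) (g a) = algebraMap R (FractionRing R) (j a) := fun a => by
    rw [aeval_algHom_apply, hg]
    exact IsFractionRing.lift_algebraMap htoL a
  have hg₀ : 0 < (g f).natDegree := by
    by_contra hg₀
    have h := hg f
    rw [eq_C_of_natDegree_eq_zero (by lia : (g f).natDegree = 0), aeval_C,
      IsScalarTower.algebraMap_apply K A (FractionRing A)] at h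
    rw [← IsFractionRing.injective A (FractionRing A) h, AlgHom.commutes, algebraMap_eq,
      natDegree_C] at hf
    exact hf.false
  -- `g f` is nonconstant and takes the value `j f ∈ R` at `ι η`.
  have hint : IsIntegral R (ι η) :=
    isIntegral_of_aeval_eq_mul_aeval (A := g f) (B := 1) (j f)
      (degree_lt_degree (by simpa using hg₀)) (by simp [hιη])
  obtain ⟨h, hh⟩ := IsIntegrallyClosed.isIntegral_iff.1 hint
  refine ⟨h, fun a => ⟨g a, IsFractionRing.injective R (FractionRing R) ?_⟩⟩
  rw [← hιη, ← hh, aeval_algebraMap_apply]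

/-- Polynomials that generate a field of transcendence degree at most `1` are polynomials in a
common polynomial. -/
theorem exists_eq_aeval_of_trdeg_le_one (H : Fin n → MvPolynomial (Fin n) K)
    (htr : Algebra.trdeg K (genField H) ≤ 1) :
    ∃ (h : MvPolynomial (Fin n) K) (g : Fin n → K[X]), ∀ i, H i = aeval h (g i) := by
  by_cases hconst : ∀ i, ∃ c, H i = MvPolynomial.C c
  · choose c hc using hconst
    exact ⟨0, fun i => C (c i), fun i => by simp [hc, MvPolynomial.algebraMap_eq]⟩
  push Not at hconst
  obtain ⟨i₀, hi₀⟩ := hconst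
  obtain ⟨φ, hφ⟩ := exists_algHom_natDegree_pos hi₀
  let A := Algebra.adjoin K (Set.range H)
  let L := FractionRing (MvPolynomial (Fin n) K)
  let Hₐ : Fin n → A := fun i => ⟨H i, Algebra.subset_adjoin ⟨i, rfl⟩⟩
  let toL : A →ₐ[K] L := (IsScalarTower.toAlgHom K (MvPolynomial (Fin n) K) L).comp A.val
  have htoL : Function.Injective toL :=
    (IsFractionRing.injective (MvPolynomial (Fin n) K) L).comp Subtype.val_injective
  have hmem : ∀ a : A, toL a ∈ (genField H).toSubalgebra := by
    have hle : A ≤ (genField H).toSubalgebra.comap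
        (IsScalarTower.toAlgHom K (MvPolynomial (Fin n) K) L) := by
      refine Algebra.adjoin_le ?_
      rintro _ ⟨i, rfl⟩
      exact IntermediateField.subset_adjoin K _ ⟨i, rfl⟩
    exact fun a => hle a.2
  have htrA : Algebra.trdeg K A ≤ 1 := by
    refine le_trans ?_ htr
    exact trdeg_le_of_injective (toL.codRestrict _ hmem)
      ((AlgHom.injective_codRestrict _ _ _).2 htoL)
  have hφA : Function.Injective (φ.comp A.val) :=
    algHom_injective_of_trdeg_le_one htrA (φ.comp A.val) (f := Hₐ i₀) hφ
  obtain ⟨h, hh⟩ := exists_forall_aeval_eq_of_injective (φ.comp A.val) hφA (f := Hₐ i₀) hφ A.val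
    Subtype.val_injective
  choose g hg using fun i => hh (Hₐ i)
  exact ⟨h, g, hg⟩

end CommonPolynomial

end PolyMap

namespace PolyMap

/-! ### Degree reduction by constant matrices -/

section Echelon

open Polynomial

variable {K : Type*} [Field K] {n : ℕ}

/-- The action of constant matrices on vectors of polynomials. -/
theorem mulVec_map_mul (S T : Matrix (Fin n) (Fin n) K) (a : Fin n → K[X]) :
    ((S * T).map C).mulVec a = (S.map C).mulVec ((T.map C).mulVec a) := by
  rw [Matrix.mulVec_mulVec, ← Matrix.map_mul]

/-- Over a field, every vector of polynomials can be brought to one with strictly decreasing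
degrees. -/
theorem exists_GL_mulVec_degree_lt (a : Fin n → K[X]) :
    ∃ T : GL (Fin n) K, ∀ i j, i < j → ((T.val.map C).mulVec a) j ≠ 0 →
      (((T.val.map C).mulVec a) j).degree < (((T.val.map C).mulVec a) i).degree := by
  classical
  let wt : K[X] → ℕ := fun p => if p = 0 then 0 else p.natDegree + 1
  have hwt : ∀ p q : K[X], q ≠ 0 → p.degree < q.degree → wt p < wt q := by
    intro p q hq hpq
    simp only [wt, if_neg hq]
    split_ifs with hp
    · lia
    · have := natDegree_lt_natDegree hp hpq
      lia
  -- A minimiser of `m` works: moving a larger degree to an earlier index lowers `m`, and so does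
  -- cancelling a leading term. `wt` ranks zero below nonzero constants.
  let m : GL (Fin n) K → ℕ := fun T => ∑ i : Fin n, ((i : ℕ) + 1) * wt (((T.val.map C).mulVec a) i)
  obtain ⟨T, hT⟩ : ∃ T, ∀ S, m T ≤ m S :=
    ⟨Function.argmin m, fun S => Function.argmin_le m S⟩
  refine ⟨T, fun i j hij hj => ?_⟩
  by_contra hlt
  set b := (T.val.map C).mulVec a with hb
  rw [not_lt] at hlt
  rcases hlt.lt_or_eq with hlt | heq
  · have := hT (Matrix.GeneralLinearGroup.swap K i j * T)
    have hmul : ((((Matrix.GeneralLinearGroup.swap K i j * T : GL (Fin n) K)).val.map C).mulVec a)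
        = fun k => b (Equiv.swap i j k) := by
      rw [Units.val_mul, mulVec_map_mul, ← hb]
      ext1 k
      rw [show ((Matrix.GeneralLinearGroup.swap K i j).val.map C : Matrix (Fin n) (Fin n) K[X]) =
        Matrix.swap K[X] i j from Matrix.map_swap _ _ _, Matrix.swap_mulVec]
      rfl
    simp only [m, hmul, ← hb] at this
    have hsplit : ∀ f : Fin n → ℕ, ∑ k, f k = f i + (f j + ∑ k ∈ (Finset.univ.erase i).erase j, f k) :=
      fun f => by
        rw [Finset.add_sum_erase _ _ (by simp [hij.ne']), Finset.add_sum_erase _ _ (by simp)]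
    rw [hsplit, hsplit] at this
    have hrest : ∑ k ∈ (Finset.univ.erase i).erase j, ((k : ℕ) + 1) * wt (b (Equiv.swap i j k)) =
        ∑ k ∈ (Finset.univ.erase i).erase j, ((k : ℕ) + 1) * wt (b k) := by
      refine Finset.sum_congr rfl fun k hk => ?_
      simp only [Finset.mem_erase] at hk
      rw [Equiv.swap_apply_of_ne_of_ne hk.2.1 hk.1]
    rw [hrest, Equiv.swap_apply_left, Equiv.swap_apply_right] at this
    have hw := hwt _ _ hj hlt
    have hij' : (i : ℕ) < j := hij
    nlinarith
  · have hi : b i ≠ 0 := fun h => hj (degree_eq_bot.1 (by rw [← heq, h, degree_zero]))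
    set c := (b j).leadingCoeff / (b i).leadingCoeff with hc
    have hc0 : c ≠ 0 := div_ne_zero (leadingCoeff_ne_zero.2 hj) (leadingCoeff_ne_zero.2 hi)
    have hS : (Matrix.transvection j i (-c)).det ≠ 0 := by
      rw [Matrix.det_transvection_of_ne _ _ hij.ne']
      exact one_ne_zero
    have := hT (Matrix.GeneralLinearGroup.mkOfDetNeZero _ hS * T)
    have hmul : (((Matrix.GeneralLinearGroup.mkOfDetNeZero _ hS * T : GL (Fin n) K)).val.map C).mulVec a
        = b + Pi.single j (-(C c * b i)) := by
      rw [Units.val_mul, mulVec_map_mul, ← hb]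
      change ((Matrix.transvection j i (-c)).map C).mulVec b = _
      rw [Matrix.transvection, Matrix.map_add _ (map_add C), Matrix.map_one _ (map_zero C) (map_one C),
        Matrix.add_mulVec, Matrix.one_mulVec, Matrix.map_single, Matrix.single_mulVec]
      simp [Pi.single]
    simp only [m, hmul, ← hb] at this
    have hlt' : wt (b j - C c * b i) < wt (b j) := by
      refine hwt _ _ hj (degree_sub_lt_left ?_ hj ?_)
      · rw [degree_C_mul hc0, heq]
      · rw [leadingCoeff_mul, leadingCoeff_C, hc, div_mul_cancel₀ _ (leadingCoeff_ne_zero.2 hi)]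
    refine this.not_gt (Finset.sum_lt_sum (fun k _ => ?_) ⟨j, Finset.mem_univ j, ?_⟩)
    · by_cases hk : k = j
      · subst hk
        rw [Pi.add_apply, Pi.single_eq_same, ← sub_eq_add_neg]
        exact Nat.mul_le_mul_left _ hlt'.le
      · simp [hk]
    · rw [Pi.add_apply, Pi.single_eq_same, ← sub_eq_add_neg]
      exact Nat.mul_lt_mul_of_pos_left hlt' (Nat.succ_pos _)

end Echelon

end PolyMap

namespace PolyMap

/-! ### Total degrees and cancellation -/

section Degree

open MvPolynomial

variable {K : Type*} [Field K] {n : ℕ}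

theorem totalDegree_aeval {σ : Type*} (h : MvPolynomial σ K) (p : Polynomial K) :
    (Polynomial.aeval h p).totalDegree = p.natDegree * h.totalDegree := by
  rcases Nat.eq_zero_or_pos h.totalDegree with h0 | h0
  · rw [h0, mul_zero, totalDegree_eq_zero_iff_eq_C.1 h0, ← algebraMap_eq,
      Polynomial.aeval_algebraMap_apply, algebraMap_eq, totalDegree_C]
  have hh : h ≠ 0 := by
    rintro rfl
    simp at h0
  have hpow : ∀ m, (h ^ m).totalDegree = m * h.totalDegree := fun m => by
    induction m with
    | zero => simp
    | succ m ih =>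
      rw [pow_succ, totalDegree_mul_of_isDomain (pow_ne_zero _ hh) hh, ih, Nat.succ_mul]
  induction hd : p.natDegree using Nat.strong_induction_on generalizing p with
  | _ d ih =>
    rcases Nat.eq_zero_or_pos d with rfl | hd0
    · rw [Polynomial.eq_C_of_natDegree_eq_zero hd, Polynomial.aeval_C, algebraMap_eq,
        totalDegree_C, zero_mul]
    have hp : p ≠ 0 := by
      rintro rfl
      simp at hd
      lia
    have hlt : p.eraseLead.natDegree < d := by
      have := p.eraseLead_natDegree_le
      lia
    have hlead : (C p.leadingCoeff * h ^ d).totalDegree = d * h.totalDegree := by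
      rw [totalDegree_mul_of_isDomain (by simpa using hp) (pow_ne_zero _ hh), totalDegree_C,
        zero_add, hpow]
    have := ih _ hlt p.eraseLead rfl
    rw [← p.eraseLead_add_monomial_natDegree_leadingCoeff, map_add, Polynomial.aeval_monomial, hd,
      algebraMap_eq, add_comm, totalDegree_add_eq_left_of_totalDegree_lt, hlead]
    rw [this, hlead]
    exact Nat.mul_lt_mul_of_pos_right hlt h0

/-- Only an inequality is available: in positive characteristic the degree may drop by more than
one. -/
theorem totalDegree_pderiv_lt {σ : Type*} {h : MvPolynomial σ K} (h0 : 0 < h.totalDegree) (i : σ) :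
    (pderiv i h).totalDegree < h.totalDegree := by
  rw [totalDegree, Finset.sup_lt_iff h0]
  intro s hs
  rw [mem_support_iff, coeff_pderiv] at hs
  have hmem : s + Finsupp.single i 1 ∈ h.support := mem_support_iff.2 (left_ne_zero_of_mul hs)
  have := le_totalDegree hmem
  rw [Finsupp.sum_add_index' (by simp) (by simp)] at this
  simp at this
  lia

/-- If `∑ aᵢ(h) wᵢ` is constant, where the `aᵢ` have strictly decreasing degrees and the `wᵢ`
have smaller degree than `h`, then at most one summand is nonzero, and it is constant. -/
theorem sum_aeval_mul_eq_C {h : MvPolynomial (Fin n) K} (a : Fin n → Polynomial K)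
    (ha : ∀ i j, i < j → a j ≠ 0 → (a j).degree < (a i).degree)
    (w : Fin n → MvPolynomial (Fin n) K) (hw : ∀ i, (w i).totalDegree < h.totalDegree) {c : K}
    (hsum : ∑ i, Polynomial.aeval h (a i) * w i = C c) {i : Fin n} (hai : a i ≠ 0)
    (hwi : w i ≠ 0) : (a i).natDegree = 0 ∧ Polynomial.aeval h (a i) * w i = C c := by
  have hd : 0 < h.totalDegree := (Nat.zero_le _).trans_lt (hw i)
  have haeval : ∀ p : Polynomial K, p ≠ 0 → Polynomial.aeval h p ≠ 0 := by
    intro p hp h0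
    have hdeg := totalDegree_aeval h p
    rw [h0, totalDegree_zero, eq_comm, mul_eq_zero, or_iff_left hd.ne'] at hdeg
    rw [Polynomial.eq_C_of_natDegree_eq_zero hdeg] at h0 hp
    simp_all
  classical
  -- The first nonzero summand has strictly the largest degree, because `deg (w j) < deg h` cannot
  -- make up for a drop in the degree of `a j`.
  obtain ⟨k, hk, hmin⟩ : ∃ k, (a k ≠ 0 ∧ w k ≠ 0) ∧ ∀ j, a j ≠ 0 ∧ w j ≠ 0 → k ≤ j := by
    obtain ⟨k, hk, hmin⟩ := (Finset.univ.filter fun j => a j ≠ 0 ∧ w j ≠ 0).exists_minimal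
      ⟨i, by simp [hai, hwi]⟩
    simp only [Finset.mem_filter, Finset.mem_univ, true_and] at hk hmin
    exact ⟨k, hk, fun j hj => (le_total k j).elim id fun h => hmin hj h⟩
  have hdeg : ∀ j, a j ≠ 0 → w j ≠ 0 → (Polynomial.aeval h (a j) * w j).totalDegree =
      (a j).natDegree * h.totalDegree + (w j).totalDegree := fun j h1 h2 => by
    rw [totalDegree_mul_of_isDomain (haeval _ h1) h2, totalDegree_aeval]
  have hnat : ∀ j, j ≠ k → a j ≠ 0 → w j ≠ 0 → (a j).natDegree < (a k).natDegree :=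
    fun j hj h1 h2 => Polynomial.natDegree_lt_natDegree h1
      (ha k j (lt_of_le_of_ne (hmin j ⟨h1, h2⟩) hj.symm) h1)
  rw [← Finset.add_sum_erase _ _ (Finset.mem_univ k)] at hsum
  have hk0 : (a k).natDegree = 0 := by
    by_contra hpos
    have hterm : 0 < (Polynomial.aeval h (a k) * w k).totalDegree := by
      rw [hdeg k hk.1 hk.2]
      have := Nat.mul_pos (Nat.pos_of_ne_zero hpos) hd
      lia
    have hrest : (∑ j ∈ Finset.univ.erase k, Polynomial.aeval h (a j) * w j).totalDegree <
        (Polynomial.aeval h (a k) * w k).totalDegree := by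
      refine (totalDegree_finsetSum _ _).trans_lt ((Finset.sup_lt_iff hterm).2 fun j hj => ?_)
      by_cases h1 : a j = 0
      · simpa [h1] using hterm
      by_cases h2 : w j = 0
      · simpa [h2] using hterm
      have hlt := hnat j (Finset.ne_of_mem_erase hj) h1 h2
      rw [hdeg j h1 h2, hdeg k hk.1 hk.2]
      have := hw j
      nlinarith
    have := totalDegree_add_eq_left_of_totalDegree_lt hrest
    rw [hsum, totalDegree_C] at this
    lia
  have huniq : ∀ j, a j ≠ 0 → w j ≠ 0 → j = k := by
    intro j h1 h2
    by_contra hj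
    have := hnat j hj h1 h2
    lia
  have hik := huniq i hai hwi
  subst hik
  refine ⟨hk0, ?_⟩
  rwa [Finset.sum_eq_zero, add_zero] at hsum
  intro j hj
  by_contra hne
  refine Finset.ne_of_mem_erase hj (huniq j ?_ (right_ne_zero_of_mul hne))
  rintro h0
  simp [h0] at hne

end Degree

end PolyMap

namespace PolyMap

/-! ### Rank-one Jacobians and conjugation -/

section Jacobian

open MvPolynomial

variable {K : Type*} [Field K] {n : ℕ}

/-- The Jacobian matrix of a polynomial map whose components are polynomials in `h`. -/
theorem jacobian_aeval (h : MvPolynomial (Fin n) K) (g : Fin n → Polynomial K) :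
    jacobian (fun i => Polynomial.aeval h (g i)) =
      Matrix.vecMulVec (fun i => Polynomial.aeval h (Polynomial.derivative (g i)))
        (fun j => pderiv j h) := by
  ext1 i j
  rw [jacobian, Matrix.of_apply, Derivation.comp_aeval_eq, smul_eq_mul, Matrix.vecMulVec_apply]

theorem jacobian_X_add {F H : Fin n → MvPolynomial (Fin n) K} (hF : ∀ i, F i = X i + H i) :
    jacobian F = 1 + jacobian H := by
  ext1 i j
  simp [jacobian, hF, Matrix.one_apply, pderiv_X, Pi.single_apply]

theorem det_one_add_vecMulVec {R : Type*} [CommRing R] (u v : Fin n → R) :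
    (1 + Matrix.vecMulVec u v).det = 1 + (Matrix.vecMulVec u v).trace := by
  rw [Matrix.vecMulVec_eq Unit, Matrix.det_one_add_replicateCol_mul_replicateRow,
    ← Matrix.vecMulVec_eq Unit, Matrix.trace_vecMulVec, dotProduct_comm]

theorem map_C_inv_mul (T : GL (Fin n) K) :
    (T⁻¹ : GL (Fin n) K).val.map (C : K →+* MvPolynomial (Fin n) K) *
      T.val.map (C : K →+* MvPolynomial (Fin n) K) = 1 := by
  rw [← Matrix.map_mul, ← Units.val_mul, inv_mul_cancel, Units.val_one,
    Matrix.map_one _ (map_zero C) (map_one C)]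

/-- Substituting `x` for `y` in `M(x) M(y) = 0`. -/
theorem mul_self_eq_zero_of_inX_mul_inY {M : Matrix (Fin n) (Fin n) (MvPolynomial (Fin n) K)}
    (h : inX M * inY M = 0) : M * M = 0 := by
  let φ : MvPolynomial (Fin n ⊕ Fin n) K →ₐ[K] MvPolynomial (Fin n) K := aeval (Sum.elim X X)
  have := congrArg (fun A => A.map φ) h
  simp only [inX, inY, Matrix.map_mul, Matrix.map_map] at this
  have hl : (φ ∘ rename Sum.inl : MvPolynomial (Fin n) K → _) = id := by
    ext1 p
    rw [Function.comp_apply, aeval_rename, Sum.elim_comp_inl, aeval_X_left_apply, id]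
  have hr : (φ ∘ rename Sum.inr : MvPolynomial (Fin n) K → _) = id := by
    ext1 p
    rw [Function.comp_apply, aeval_rename, Sum.elim_comp_inr, aeval_X_left_apply, id]
  simpa [hl, hr] using this

/-- Substitution fixes constant matrices, so the inner `T⁻¹ T` cancels and the outer factors are
invertible. -/
theorem inX_mul_inY_conj (T : GL (Fin n) K) {M : Matrix (Fin n) (Fin n) (MvPolynomial (Fin n) K)}
    (h : inX (T.val.map (C : K →+* MvPolynomial (Fin n) K) * M *
        (T⁻¹ : GL (Fin n) K).val.map (C : K →+* MvPolynomial (Fin n) K)) *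
      inY (T.val.map (C : K →+* MvPolynomial (Fin n) K) * M *
        (T⁻¹ : GL (Fin n) K).val.map (C : K →+* MvPolynomial (Fin n) K)) = 0) :
    inX M * inY M = 0 := by
  have hX : ∀ S : Matrix (Fin n) (Fin n) K, inX (S.map (C : K →+* MvPolynomial (Fin n) K)) =
      S.map (C : K →+* MvPolynomial (Fin n ⊕ Fin n) K) := fun S => by ext1 i j; simp [inX]
  have hY : ∀ S : Matrix (Fin n) (Fin n) K, inY (S.map (C : K →+* MvPolynomial (Fin n) K)) =
      S.map (C : K →+* MvPolynomial (Fin n ⊕ Fin n) K) := fun S => by ext1 i j; simp [inY]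
  have hXm : ∀ A B : Matrix (Fin n) (Fin n) (MvPolynomial (Fin n) K),
      inX (A * B) = inX A * inX B := fun A B => Matrix.map_mul
  have hYm : ∀ A B : Matrix (Fin n) (Fin n) (MvPolynomial (Fin n) K),
      inY (A * B) = inY A * inY B := fun A B => Matrix.map_mul
  have hinv : ∀ S S' : Matrix (Fin n) (Fin n) K, S * S' = 1 →
      S.map (C : K →+* MvPolynomial (Fin n ⊕ Fin n) K) * S'.map C = 1 := fun S S' hS => by
    rw [← Matrix.map_mul, hS, Matrix.map_one _ (map_zero C) (map_one C)]
  have h1 := hinv T.val (T⁻¹ : GL (Fin n) K).val T.mul_inv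
  have h2 := hinv (T⁻¹ : GL (Fin n) K).val T.val T.inv_mul
  rw [hXm, hXm, hYm, hYm, hX, hX, hY, hY] at h
  have h3 := congrArg (fun A => (T⁻¹ : GL (Fin n) K).val.map C * A * T.val.map C) h
  simp only [mul_zero, zero_mul] at h3
  rw [← h3]
  simp only [Matrix.mul_assoc]
  rw [h2, Matrix.mul_one, ← Matrix.mul_assoc _ _ (inX M * _), h2, Matrix.one_mul,
    ← Matrix.mul_assoc _ (T.val.map C) _, h2, Matrix.one_mul]

end Jacobian

end PolyMap

/-! ### The main theorem -/

theorem theorem3p1 {K : Type*} [Field K] {n : ℕ}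
    (F H : Fin n → MvPolynomial (Fin n) K)
    (hF : ∀ i, F i = MvPolynomial.X i + H i)
    (hKeller : PolyMap.IsKeller F)
    (htrdeg : Algebra.trdeg K (PolyMap.genField H) = 1) :
    (∃ N : Matrix (Fin n) (Fin n) (MvPolynomial (Fin n) K),
      PolyMap.IsTriangular N ∧ PolyMap.SimilarOver (PolyMap.jacobian H) N) ∧
    List.TFAE
      [(PolyMap.jacobian F).det = 1,
       IsNilpotent (PolyMap.jacobian H),
       PolyMap.inX (PolyMap.jacobian H) * PolyMap.inY (PolyMap.jacobian H) = 0] := by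
  open MvPolynomial PolyMap in
  obtain ⟨h, g, hg⟩ := exists_eq_aeval_of_trdeg_le_one H htrdeg.le
  obtain rfl : H = fun i => Polynomial.aeval h (g i) := funext hg
  have hdet : (jacobian F).det = 1 + (jacobian fun i => Polynomial.aeval h (g i)).trace := by
    rw [jacobian_X_add hF, jacobian_aeval, det_one_add_vecMulVec]
  obtain ⟨c, -, hc⟩ := hKeller
  rw [hdet] at hc ⊢
  obtain ⟨T, hT⟩ := exists_GL_mulVec_degree_lt fun i => Polynomial.derivative (g i)
  set J := jacobian fun i => Polynomial.aeval h (g i) with hJ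
  set a := (T.val.map Polynomial.C).mulVec fun i => Polynomial.derivative (g i) with ha
  set w := Matrix.vecMul (fun j => pderiv j h) ((T⁻¹ : GL (Fin n) K).val.map C) with hw
  have hN : T.val.map (C : K →+* MvPolynomial (Fin n) K) * J *
      (T⁻¹ : GL (Fin n) K).val.map (C : K →+* MvPolynomial (Fin n) K) =
      Matrix.vecMulVec (fun i => Polynomial.aeval h (a i)) w := by
    rw [hJ, jacobian_aeval, Matrix.mul_vecMulVec, Matrix.vecMulVec_mul]
    congr 1
    ext1 i
    simp [ha, Matrix.mulVec, dotProduct, algebraMap_eq]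
  have htrace : ∑ i, Polynomial.aeval h (a i) * w i = C (c - 1) := by
    have : J.trace = C (c - 1) := by rw [C_sub, C_1, ← hc]; ring
    rw [← this, ← Matrix.one_mul J, ← map_C_inv_mul T, ← Matrix.trace_mul_cycle, hN,
      Matrix.trace_vecMulVec, dotProduct]
  have hconst : ∀ i, a i ≠ 0 → w i ≠ 0 → (a i).natDegree = 0 ∧
      Polynomial.aeval h (a i) * w i = C (c - 1) := by
    intro i hai hwi
    have h0 : 0 < h.totalDegree := by
      rw [Nat.pos_iff_ne_zero]
      intro h0
      apply hwi
      rw [hw, totalDegree_eq_zero_iff_eq_C.1 h0]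
      simp [Matrix.vecMul, dotProduct]
    refine sum_aeval_mul_eq_C a hT w (fun j => ?_) htrace hai hwi
    refine (totalDegree_finsetSum _ _).trans_lt ((Finset.sup_lt_iff h0).2 fun k _ => ?_)
    refine (totalDegree_mul _ _).trans_lt ?_
    change _ + (C ((T⁻¹ : GL (Fin n) K).val k j)).totalDegree < _
    rw [totalDegree_C, add_zero]
    exact totalDegree_pderiv_lt h0 k
  refine ⟨⟨Matrix.vecMulVec (fun i => Polynomial.aeval h (a i)) w, Or.inl fun i j hij => ?_,
    T⁻¹, ?_⟩, ?_⟩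
  · rw [Matrix.vecMulVec_apply]
    -- Here `w j ≠ 0` forces `a j` to be constant, yet its degree exceeds that of the nonzero `a i`.
    by_contra hne
    have hai : a i ≠ 0 := fun h0 => hne (by simp [h0])
    have hlt := hT j i hij hai
    have haj : a j ≠ 0 := fun h0 => by simp [h0] at hlt
    have := (hconst j haj (right_ne_zero_of_mul hne)).1
    have := Polynomial.natDegree_lt_natDegree hai hlt
    lia
  · rw [inv_inv, hN]
  tfae_have 1 → 3 := by
    intro h1
    have hc1 : (C (c - 1) : MvPolynomial (Fin n) K) = 0 := by
      rw [C_sub, C_1, ← hc, h1, sub_self]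
    refine inX_mul_inY_conj T ?_
    rw [hN]
    ext1 i j
    rw [Matrix.mul_apply, Matrix.zero_apply]
    -- The `k`-th term contains `w k` in `x` and `a k (h)` in `y`; one of them is identically zero,
    -- so the separate variables do no harm.
    refine Finset.sum_eq_zero fun k _ => ?_
    simp only [inX, inY, Matrix.map_apply, Matrix.vecMulVec_apply, map_mul]
    by_cases hak : a k = 0
    · simp [hak]
    by_cases hwk : w k = 0
    · simp [hwk]
    have h0 := (hconst k hak hwk).2
    rw [hc1, mul_eq_zero] at h0
    rcases h0 with h0 | h0
    · simp [h0]
    · exact absurd h0 hwk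
  tfae_have 3 → 2 := fun h3 => ⟨2, by rw [pow_two, mul_self_eq_zero_of_inX_mul_inY h3]⟩
  -- The trace of a nilpotent matrix is nilpotent, hence zero in the domain `K[x]`.
  tfae_have 2 → 1 := fun h2 => by
    rw [(Matrix.isNilpotent_trace_of_isNilpotent h2).eq_zero, add_zero]
  tfae_finish
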